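/- Let $(X,\mathcal B,\mu)$ be a standard Borel probability space, and let $L_p=L_p(X,\mu;\mathbb C)$. Let $U=(U_t)_{t\in\mathbb R}$ be a unitary one-parameter $C_0$-group (strongly continuous group) on $L_2$ with infinitesimal generator $A$, with domain $D(A)$. Suppose that $U_t(L_\infty)\subset L_\infty$ for all $t\in\mathbb R$, and that the constant function $\mathbf 1$ belongs to $D(A)$ with $A\mathbf 1\in L_\infty$. Then the following are equivalent. (i) For every $t\in\mathbb R$ there exist an a.e. invertible, measurable and measure-preserving map $T_t\colon X\to X$ and a function $\psi_t\colon X\to\mathbb C$ such that $U_tf=\psi_t\cdot(f\circ T_t)$ a.e. for all $f\in L_2$. (ii) For every $t\in\mathbb R$ one has $|U_t\mathbf 1|=1$ a.e.; moreover, $D(A)\cap L_\infty$ is an algebra (it is closed under pointwise a.e. multiplication), and the operator $B=A-(A\mathbf 1)I\colon f\mapsto Af-(A\mathbf 1)\cdot f$ is a derivation on it, that is, $B(fg)=(Bf)\,g+f\,(Bg)$ for all $f,g\in D(A)\cap L_\infty$. -/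

import Mathlib

open MeasureTheory
open scoped ENNReal

noncomputable section

namespace KoopmanGroup

variable {X : Type*} [MeasurableSpace X] {μ : Measure X}

/-- A unitary one-parameter `C₀`-group on `L₂(X)`. -/
structure IsUnitaryC0Group (U : ℝ → (Lp ℂ 2 μ →L[ℂ] Lp ℂ 2 μ)) : Prop where
  map_zero : U 0 = 1
  map_add : ∀ s t : ℝ, U (s + t) = U s * U t
  mem_unitary : ∀ t : ℝ, U t ∈ unitary (Lp ℂ 2 μ →L[ℂ] Lp ℂ 2 μ)
  continuous : ∀ f : Lp ℂ 2 μ, Continuous fun t : ℝ => U t f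

/-- The infinitesimal generator of a one-parameter family `U` of operators on `L₂(X)`: its domain
consists of all `f` for which the orbit `t ↦ U t f` is differentiable at `0`, that is, for which
`(U t f - U 0 f) / t` converges in norm as `t → 0`, and it maps `f` to that derivative. -/
def generator (U : ℝ → (Lp ℂ 2 μ →L[ℂ] Lp ℂ 2 μ)) : Lp ℂ 2 μ →ₗ.[ℂ] Lp ℂ 2 μ where
  domain :=
    { carrier := {f | DifferentiableAt ℝ (fun t : ℝ => U t f) 0}
      zero_mem' := by simp
      add_mem' := by
        intro f g hf hg
        simpa only [Set.mem_ofPred_eq, map_add] using DifferentiableAt.fun_add hf hg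
      smul_mem' := by
        intro c f hf
        simpa only [Set.mem_ofPred_eq, map_smul] using DifferentiableAt.fun_const_smul hf c }
  toFun :=
    { toFun := fun f => deriv (fun t : ℝ => U t (f : Lp ℂ 2 μ)) 0
      map_add' := by
        intro f g
        simpa only [Submodule.coe_add, map_add] using deriv_fun_add f.2 g.2
      map_smul' := by
        intro c f
        simpa only [Submodule.coe_smul, map_smul, RingHom.id_apply] using
          deriv_fun_const_smul c f.2 }

/-- `f ∈ L_∞(X)`, for a class `f ∈ L₂(X)`. -/
def IsBdd (f : Lp ℂ 2 μ) : Prop := MemLp (f : X → ℂ) ∞ μ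

/-- The space `D ∩ L_∞(X)`, for a linear subspace `D` of `L₂(X)`. -/
def interBdd (D : Submodule ℂ (Lp ℂ 2 μ)) : Submodule ℂ (Lp ℂ 2 μ) where
  carrier := {f | f ∈ D ∧ IsBdd f}
  zero_mem' := ⟨D.zero_mem, MemLp.ae_eq (Lp.coeFn_zero ℂ 2 μ).symm MemLp.zero⟩
  add_mem' := by
    rintro f g ⟨hf, hf'⟩ ⟨hg, hg'⟩
    exact ⟨D.add_mem hf hg, MemLp.ae_eq (Lp.coeFn_add f g).symm (MemLp.add hf' hg')⟩
  smul_mem' := by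
    rintro c f ⟨hf, hf'⟩
    exact ⟨D.smul_mem c hf, MemLp.ae_eq (Lp.coeFn_smul c f).symm (MemLp.const_smul hf' c)⟩

/-- A linear space of (classes of) functions is an algebra if it is closed under pointwise a.e.
multiplication. -/
def IsAlgebra (D : Submodule ℂ (Lp ℂ 2 μ)) : Prop :=
  ∀ f ∈ D, ∀ g ∈ D, ∃ h ∈ D, (h : X → ℂ) =ᵐ[μ] fun x => f x * g x

/-- The operator `B` is a derivation on the subspace `D` of its domain: `B(fg) = (Bf) g + f (Bg)`
for all `f, g ∈ D` with product `fg = h ∈ D`. -/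
def IsDerivationOn (B : Lp ℂ 2 μ →ₗ.[ℂ] Lp ℂ 2 μ) (D : Submodule ℂ (Lp ℂ 2 μ)) : Prop :=
  D ≤ B.domain ∧
    ∀ f g h : B.domain, (f : Lp ℂ 2 μ) ∈ D → (g : Lp ℂ 2 μ) ∈ D → (h : Lp ℂ 2 μ) ∈ D →
      ((h : Lp ℂ 2 μ) : X → ℂ) =ᵐ[μ]
        (fun x => ((f : Lp ℂ 2 μ) : X → ℂ) x * ((g : Lp ℂ 2 μ) : X → ℂ) x) →
      (B h : X → ℂ) =ᵐ[μ] fun x =>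
        (B f : X → ℂ) x * ((g : Lp ℂ 2 μ) : X → ℂ) x
          + ((f : Lp ℂ 2 μ) : X → ℂ) x * (B g : X → ℂ) x

/-- The bounded operator `f ↦ a f` on `L₂(X)` of multiplication by `a ∈ L_∞(X)`. -/
def mulOp (a : Lp ℂ ∞ μ) : Lp ℂ 2 μ →L[ℂ] Lp ℂ 2 μ :=
  (ContinuousLinearMap.mul ℂ ℂ).holderL μ ∞ 2 2 a

/-- The constant function `1` as an element of `L₂(X)`. -/
def one (μ : Measure X) [IsFiniteMeasure μ] : Lp ℂ 2 μ := Lp.const 2 μ (1 : ℂ)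

/-- `T` is invertible up to null sets, with measurable inverse. -/
def IsAEInvertible (μ : Measure X) (T : X → X) : Prop :=
  ∃ S : X → X, Measurable S ∧ (∀ᵐ x ∂μ, S (T x) = x) ∧ ∀ᵐ x ∂μ, T (S x) = x

end KoopmanGroup

end

/-! Write `a = A1`. For (i) ⇒ (ii), testing `U t` on indicators shows that the weight `U t 1` is
unimodular, so `U t (fg) = conj(U t 1) (U t f)(U t g)`. Differentiating at `0` gives `A(fg) = f Ag +
g Af + conj(a) fg`; the case `f = g = 1` forces `conj a = -a`, and this is the Leibniz rule for `A -
a`.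

For (ii) ⇒ (i), both `(U s f)(U s g)` and `(U s 1)(U s (fg))` solve `R' = AR + aR` with the same
initial value. As `A` is skew and `a` is bounded, Gronwall applied to `‖R‖²` makes them equal
(`IsUnitaryC0Group.mulBdd_map_map`). The product rule needs orbits that are locally uniformly
bounded, which Baire's theorem supplies (`IsUnitaryC0Group.exists_bddBy_orbit`); averaging then
makes `D(A) ∩ L_∞` dense. Hence `conj(U t 1) U t` is a multiplicative isometry fixing `1`. It maps
indicators to indicators, and on a standard Borel space such a map is composition with a point map
(`IsMulIsometry.exists_measurePreserving`). The group law inverts that map. -/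

namespace KoopmanGroup

open Filter Topology

/-! ### Multiplication of bounded classes in `L₂` and its product rule -/

section Toolkit

variable {X : Type*} [MeasurableSpace X] {μ : Measure X}

/-- The class `f` is bounded by `C` almost everywhere. -/
def BddBy (C : ℝ) (f : Lp ℂ 2 μ) : Prop := ∀ᵐ x ∂μ, ‖f x‖ ≤ C

theorem BddBy.isBdd {C : ℝ} {f : Lp ℂ 2 μ} (h : BddBy C f) : IsBdd f :=
  memLp_top_of_bound (Lp.aestronglyMeasurable f) C h

theorem IsBdd.exists_bddBy {f : Lp ℂ 2 μ} (h : IsBdd f) : ∃ C, 0 ≤ C ∧ BddBy C f := by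
  refine ⟨(eLpNormEssSup f μ).toReal, ENNReal.toReal_nonneg, ?_⟩
  have hlt : eLpNormEssSup f μ < ∞ := by simpa using h.2
  filter_upwards [ae_le_eLpNormEssSup (f := f) (μ := μ)] with x hx
  rw [← toReal_enorm]
  exact ENNReal.toReal_mono hlt.ne hx

theorem BddBy.mono {C C' : ℝ} {f : Lp ℂ 2 μ} (h : BddBy C f) (hC : C ≤ C') : BddBy C' f := by
  filter_upwards [h] with x hx using hx.trans hC

theorem BddBy.sub {C C' : ℝ} {f g : Lp ℂ 2 μ} (hf : BddBy C f) (hg : BddBy C' g) :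
    BddBy (C + C') (f - g) := by
  filter_upwards [hf, hg, Lp.coeFn_sub f g] with x h1 h2 h3
  rw [h3]
  exact (norm_sub_le _ _).trans (add_le_add h1 h2)

theorem BddBy.smul {C : ℝ} {f : Lp ℂ 2 μ} (hf : BddBy C f) (c : ℂ) : BddBy (‖c‖ * C) (c • f) := by
  filter_upwards [hf, Lp.coeFn_smul c f] with x h1 h2
  rw [h2, Pi.smul_apply, norm_smul]
  exact mul_le_mul_of_nonneg_left h1 (norm_nonneg c)

/-- An `L₂`-convergent sequence has a subsequence converging almost everywhere. -/
theorem isClosed_bddBy (C : ℝ) : IsClosed {f : Lp ℂ 2 μ | BddBy C f} := by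
  refine IsSeqClosed.isClosed fun u f hu hf => ?_
  obtain ⟨ns, -, hns⟩ := (tendstoInMeasure_of_tendsto_Lp hf).exists_seq_tendsto_ae
  have h : ∀ᵐ x ∂μ, ∀ n, ‖u n x‖ ≤ C := ae_all_iff.2 fun n => hu n
  filter_upwards [hns, h] with x h1 h2
  exact le_of_tendsto h1.norm (Eventually.of_forall fun n => h2 _)

theorem convex_bddBy (C : ℝ) : Convex ℝ {f : Lp ℂ 2 μ | BddBy C f} := by
  intro f hf g hg a b ha hb hab
  filter_upwards [hf, hg, Lp.coeFn_add (a • f) (b • g), Lp.coeFn_smul a f, Lp.coeFn_smul b g]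
    with x h1 h2 h3 h4 h5
  rw [h3, Pi.add_apply, h4, h5, Pi.smul_apply, Pi.smul_apply]
  calc ‖a • f x + b • g x‖ ≤ a * ‖f x‖ + b * ‖g x‖ := by
        refine (norm_add_le _ _).trans ?_
        rw [norm_smul, norm_smul, Real.norm_of_nonneg ha, Real.norm_of_nonneg hb]
    _ ≤ a * C + b * C := by gcongr
    _ = C := by rw [← add_mul, hab, one_mul]

open Classical in
/-- Multiplication by a bounded class `g ∈ L₂(X)`; it is `0` if `g` is not bounded. -/
noncomputable def mulBdd (g : Lp ℂ 2 μ) : Lp ℂ 2 μ →L[ℂ] Lp ℂ 2 μ :=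
  if h : IsBdd g then mulOp (MemLp.toLp g h) else 0

theorem coeFn_mulOp (a : Lp ℂ ∞ μ) (f : Lp ℂ 2 μ) : mulOp a f =ᵐ[μ] fun x => a x * f x :=
  (ContinuousLinearMap.mul ℂ ℂ).coeFn_holder a f

theorem coeFn_mulBdd {g : Lp ℂ 2 μ} (hg : IsBdd g) (f : Lp ℂ 2 μ) :
    mulBdd g f =ᵐ[μ] fun x => g x * f x := by
  rw [mulBdd, dif_pos hg]
  filter_upwards [coeFn_mulOp (MemLp.toLp g hg) f, MemLp.coeFn_toLp hg] with x h1 h2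
  rw [h1, h2]

theorem mulBdd_eq_iff {g : Lp ℂ 2 μ} (hg : IsBdd g) {f h : Lp ℂ 2 μ} :
    mulBdd g f = h ↔ (h : X → ℂ) =ᵐ[μ] fun x => g x * f x := by
  constructor
  · rintro rfl
    exact coeFn_mulBdd hg f
  · intro hh
    exact Lp.ext ((coeFn_mulBdd hg f).trans hh.symm)

theorem mulBdd_comm {f g : Lp ℂ 2 μ} (hf : IsBdd f) (hg : IsBdd g) : mulBdd f g = mulBdd g f := by
  rw [mulBdd_eq_iff hf]
  filter_upwards [coeFn_mulBdd hg f] with x hx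
  rw [hx, mul_comm]

theorem norm_mulBdd_le {C : ℝ} {g : Lp ℂ 2 μ} (hg : BddBy C g) (f : Lp ℂ 2 μ) :
    ‖mulBdd g f‖ ≤ C * ‖f‖ := by
  refine Lp.norm_le_mul_norm_of_ae_le_mul ?_
  filter_upwards [hg, coeFn_mulBdd hg.isBdd f] with x h1 h2
  rw [h2, norm_mul]
  gcongr

/-- Serves when the multiplier is small only in `L₂`: the sup bound is taken on the other factor. -/
theorem norm_mulBdd_le' {C : ℝ} {f g : Lp ℂ 2 μ} (hf : BddBy C f) (hg : IsBdd g) :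
    ‖mulBdd g f‖ ≤ C * ‖g‖ := by
  rw [← mulBdd_comm hf.isBdd hg]
  exact norm_mulBdd_le hf g

theorem mulBdd_sub_left {f g : Lp ℂ 2 μ} (hf : IsBdd f) (hg : IsBdd g) (h : Lp ℂ 2 μ) :
    mulBdd (f - g) h = mulBdd f h - mulBdd g h := by
  obtain ⟨C, -, hC⟩ := hf.exists_bddBy
  obtain ⟨C', -, hC'⟩ := hg.exists_bddBy
  rw [mulBdd_eq_iff (hC.sub hC').isBdd]
  filter_upwards [coeFn_mulBdd hf h, coeFn_mulBdd hg h, Lp.coeFn_sub f g,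
    Lp.coeFn_sub (mulBdd f h) (mulBdd g h)] with x h1 h2 h3 h4
  rw [h4, h3, Pi.sub_apply, Pi.sub_apply, h1, h2, sub_mul]

theorem BddBy.mulBdd {C C' : ℝ} {f g : Lp ℂ 2 μ} (hf : BddBy C f) (hg : BddBy C' g) :
    BddBy (C * C') (mulBdd f g) := by
  filter_upwards [hf, hg, coeFn_mulBdd hf.isBdd g] with x h1 h2 h3
  rw [h3, norm_mul]
  exact mul_le_mul h1 h2 (norm_nonneg _) ((norm_nonneg _).trans h1)

theorem IsBdd.mulBdd {f g : Lp ℂ 2 μ} (hf : IsBdd f) (hg : IsBdd g) :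
    IsBdd (mulBdd f g) := by
  obtain ⟨C, -, hC⟩ := hf.exists_bddBy
  obtain ⟨C', -, hC'⟩ := hg.exists_bddBy
  exact (hC.mulBdd hC').isBdd

theorem mulBdd_assoc {f g : Lp ℂ 2 μ} (hf : IsBdd f) (hg : IsBdd g) (h : Lp ℂ 2 μ) :
    mulBdd f (mulBdd g h) = mulBdd (mulBdd f g) h := by
  rw [mulBdd_eq_iff hf]
  filter_upwards [coeFn_mulBdd hf g, coeFn_mulBdd hg h, coeFn_mulBdd (hf.mulBdd hg) h]
    with x h1 h2 h3
  rw [h3, h1, h2, mul_assoc]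

theorem isBdd_indicatorConstLp {s : Set X} (hs : MeasurableSet s) (hμs : μ s ≠ ∞) (c : ℂ) :
    IsBdd (indicatorConstLp 2 hs hμs c) := by
  refine BddBy.isBdd (C := ‖c‖) ?_
  filter_upwards [indicatorConstLp_coeFn (p := 2) (hs := hs) (hμs := hμs) (c := c)] with x hx
  rw [hx]
  exact norm_indicator_le_norm_self _ _

theorem dense_isBdd : Dense {f : Lp ℂ 2 μ | IsBdd f} := by
  intro f
  refine Lp.induction (p := 2) (by simp) (motive := fun f => f ∈ closure {f : Lp ℂ 2 μ | IsBdd f})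
    ?_ ?_ isClosed_closure f
  · intro c s hs hμs
    exact subset_closure (isBdd_indicatorConstLp hs hμs.ne c)
  · intro f g hf hg _ h1 h2
    have e : {f : Lp ℂ 2 μ | IsBdd f} = (interBdd (⊤ : Submodule ℂ (Lp ℂ 2 μ)) : Set _) := by
      ext f
      exact ⟨fun h => ⟨trivial, h⟩, fun h => h.2⟩
    rw [e] at h1 h2 ⊢
    exact (interBdd (⊤ : Submodule ℂ (Lp ℂ 2 μ))).topologicalClosure.add_mem h1 h2

/-- The product is not continuous on `L₂`, but a uniform bound on one factor suffices: replace `g`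
by a bounded `g'` close to it, so that `(u i - f) g'` is controlled by the `L₂` norm of `u i - f`.
-/
theorem tendsto_mulBdd {ι : Type*} {l : Filter ι} {C : ℝ} {u v : ι → Lp ℂ 2 μ} {f g : Lp ℂ 2 μ}
    (hu : Tendsto u l (𝓝 f)) (hv : Tendsto v l (𝓝 g)) (hC : ∀ᶠ i in l, BddBy C (u i))
    (hf : IsBdd f) : Tendsto (fun i => mulBdd (u i) (v i)) l (𝓝 (mulBdd f g)) := by
  obtain ⟨C₁, hC₁, hf'⟩ := hf.exists_bddBy
  set M := max C C₁ with hM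
  have hM0 : 0 ≤ M := hC₁.trans (le_max_right _ _)
  rw [Metric.tendsto_nhds]
  intro ε hε
  obtain ⟨g', hg', hgg⟩ := Metric.mem_closure_iff.1 (dense_isBdd g) (ε / (4 * (M + 1)))
    (by positivity)
  obtain ⟨K, hK, hg''⟩ := IsBdd.exists_bddBy hg'
  have h1 : ∀ᶠ i in l, dist (u i) f < ε / (4 * (K + 1)) :=
    Metric.tendsto_nhds.1 hu _ (by positivity)
  have h2 : ∀ᶠ i in l, dist (v i) g < ε / (4 * (M + 1)) :=
    Metric.tendsto_nhds.1 hv _ (by positivity)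
  filter_upwards [h1, h2, hC] with i h1 h2 h3
  rw [dist_eq_norm] at h1 h2 hgg ⊢
  have hui : BddBy M (u i) := h3.mono (le_max_left _ _)
  have e : mulBdd (u i) (v i) - mulBdd f g = mulBdd (u i) (v i - g) + mulBdd (u i) (g - g')
      + mulBdd (u i - f) g' - mulBdd f (g - g') := by
    rw [mulBdd_sub_left hui.isBdd hf, map_sub, map_sub, map_sub]
    abel
  have b1 := norm_mulBdd_le hui (v i - g)
  have b2 := norm_mulBdd_le hui (g - g')
  have b3 := norm_mulBdd_le' hg'' (hui.sub hf').isBdd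
  have b4 := norm_mulBdd_le (hf'.mono (le_max_right C C₁)) (g - g')
  have c1 : M * ‖v i - g‖ < ε / 4 := by
    calc M * ‖v i - g‖ ≤ (M + 1) * ‖v i - g‖ := by gcongr; linarith
      _ < (M + 1) * (ε / (4 * (M + 1))) := by gcongr
      _ = ε / 4 := by field_simp
  have c2 : M * ‖g - g'‖ < ε / 4 := by
    calc M * ‖g - g'‖ ≤ (M + 1) * ‖g - g'‖ := by gcongr; linarith
      _ < (M + 1) * (ε / (4 * (M + 1))) := by gcongr
      _ = ε / 4 := by field_simp
  have c3 : K * ‖u i - f‖ < ε / 4 := by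
    calc K * ‖u i - f‖ ≤ (K + 1) * ‖u i - f‖ := by gcongr; linarith
      _ < (K + 1) * (ε / (4 * (K + 1))) := by gcongr
      _ = ε / 4 := by field_simp
  rw [e]
  calc _ ≤ ‖mulBdd (u i) (v i - g)‖ + ‖mulBdd (u i) (g - g')‖ + ‖mulBdd (u i - f) g'‖
      + ‖mulBdd f (g - g')‖ := (norm_sub_le _ _).trans (by gcongr; exact norm_add₃_le)
    _ < ε := by linarith

/-- The slope of the product is `u t` times the slope of `v` plus `v s` times the slope of `u`. The
first multiplier moves but is uniformly bounded; the second is fixed. -/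
theorem hasDerivAt_mulBdd {C C' : ℝ} {u v : ℝ → Lp ℂ 2 μ} {u' v' : Lp ℂ 2 μ} {s : ℝ}
    (hu : HasDerivAt u u' s) (hv : HasDerivAt v v' s)
    (hC : ∀ᶠ t in 𝓝 s, BddBy C (u t)) (hC' : ∀ᶠ t in 𝓝 s, BddBy C' (v t)) :
    HasDerivAt (fun t => mulBdd (u t) (v t)) (mulBdd (u s) v' + mulBdd (v s) u') s := by
  rw [hasDerivAt_iff_tendsto_slope] at *
  have hus : IsBdd (u s) := hC.self_of_nhds.isBdd
  have hvs : IsBdd (v s) := hC'.self_of_nhds.isBdd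
  have hcu : Tendsto u (𝓝[≠] s) (𝓝 (u s)) :=
    ((hasDerivAt_iff_tendsto_slope.2 hu).continuousAt.tendsto).mono_left nhdsWithin_le_nhds
  have h1 := tendsto_mulBdd hcu hv (hC.filter_mono nhdsWithin_le_nhds) hus
  have h2 := ((mulBdd (v s)).continuous.tendsto u').comp hu
  refine (h1.add h2).congr' ?_
  filter_upwards [hC.filter_mono nhdsWithin_le_nhds] with t ht
  have hut := ht.isBdd
  obtain ⟨B, -, hB⟩ := hus.exists_bddBy
  simp only [Function.comp_apply, slope_def_module, ContinuousLinearMap.map_smul_of_tower]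
  rw [← smul_add, mulBdd_comm hvs (ht.sub hB).isBdd, mulBdd_sub_left hut hus, map_sub]
  congr 1
  abel

end Toolkit

/-! ### Group laws and the generator -/

section Group

variable {X : Type*} [MeasurableSpace X] {μ : Measure X}
  {U : ℝ → (Lp ℂ 2 μ →L[ℂ] Lp ℂ 2 μ)}

theorem IsUnitaryC0Group.norm_map (hU : IsUnitaryC0Group U) (t : ℝ) (f : Lp ℂ 2 μ) :
    ‖U t f‖ = ‖f‖ :=
  ContinuousLinearMap.norm_map_of_mem_unitary (hU.mem_unitary t) f

theorem IsUnitaryC0Group.apply_add (hU : IsUnitaryC0Group U) (s t : ℝ) (f : Lp ℂ 2 μ) :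
    U (s + t) f = U s (U t f) := by
  rw [hU.map_add, mul_apply_eq_comp]

theorem IsUnitaryC0Group.apply_zero (hU : IsUnitaryC0Group U) (f : Lp ℂ 2 μ) : U 0 f = f := by
  rw [hU.map_zero, one_apply_eq_self]

theorem IsUnitaryC0Group.apply_neg_apply (hU : IsUnitaryC0Group U) (t : ℝ) (f : Lp ℂ 2 μ) :
    U (-t) (U t f) = f := by
  rw [← hU.apply_add, neg_add_cancel, hU.apply_zero]

theorem hasDerivAt_generator (f : (generator U).domain) :
    HasDerivAt (fun t => U t f) (generator U f) 0 :=
  DifferentiableAt.hasDerivAt (f := fun t : ℝ => U t (f : Lp ℂ 2 μ)) f.2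

theorem generator_eq {f : Lp ℂ 2 μ} {f' : Lp ℂ 2 μ} (h : HasDerivAt (fun t => U t f) f' 0)
    (hf : f ∈ (generator U).domain) : generator U ⟨f, hf⟩ = f' :=
  h.deriv

end Group

/-! ### Weighted composition operators -/

section Weighted

variable {X : Type*} [MeasurableSpace X] {μ : Measure X}

/-- The algebra shared by both directions: `A(fg) = f Ag + g Af - a fg` is the Leibniz rule for `A -
a`, since each side of that rule contains `-2 a fg`. -/
theorem coeFn_derivation {f g h a : Lp ℂ 2 μ} (hf : IsBdd f) (hg : IsBdd g)
    (ha : IsBdd a) (hfg : mulBdd f g = h) (f' g' : Lp ℂ 2 μ) :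
    (mulBdd f g' + mulBdd g f' + mulBdd h (-a) - mulBdd a h : Lp ℂ 2 μ) =ᵐ[μ] fun x =>
      (f' - mulBdd a f : Lp ℂ 2 μ) x * g x + f x * (g' - mulBdd a g : Lp ℂ 2 μ) x := by
  subst hfg
  rw [map_neg]
  have hh := hf.mulBdd hg
  filter_upwards [coeFn_mulBdd hf g, coeFn_mulBdd hf g', coeFn_mulBdd hg f',
    coeFn_mulBdd hh a, coeFn_mulBdd ha f, coeFn_mulBdd ha g, coeFn_mulBdd ha (mulBdd f g),
    Lp.coeFn_sub f' (mulBdd a f), Lp.coeFn_sub g' (mulBdd a g),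
    Lp.coeFn_sub (mulBdd f g' + mulBdd g f' + -mulBdd (mulBdd f g) a) (mulBdd a (mulBdd f g)),
    Lp.coeFn_add (mulBdd f g' + mulBdd g f') (-mulBdd (mulBdd f g) a),
    Lp.coeFn_add (mulBdd f g') (mulBdd g f'), Lp.coeFn_neg (mulBdd (mulBdd f g) a)]
    with x e1 e2 e3 e4 e5 e6 e7 e8 e9 e10 e11 e12 e13
  rw [e10, Pi.sub_apply, e11, Pi.add_apply, e12, Pi.add_apply, e13, Pi.neg_apply, e8, e9,
    Pi.sub_apply, Pi.sub_apply, e2, e3, e4, e5, e6, e7, e1]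
  ring

theorem norm_sq_eq_integral (f : Lp ℂ 2 μ) : ‖f‖ ^ 2 = ∫ x, ‖f x‖ ^ 2 ∂μ := by
  rw [← real_inner_self_eq_norm_sq, L2.inner_def]
  simp_rw [real_inner_self_eq_norm_sq]

/-- Complex conjugation on `L₂(X)`. -/
noncomputable def conjL2 : Lp ℂ 2 μ →L[ℝ] Lp ℂ 2 μ :=
  (Complex.conjCLE : ℂ →L[ℝ] ℂ).compLpL 2 μ

theorem coeFn_conjL2 (f : Lp ℂ 2 μ) : conjL2 f =ᵐ[μ] fun x => star (f x) :=
  ContinuousLinearMap.coeFn_compLpL _ _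

theorem BddBy.conjL2 {C : ℝ} {f : Lp ℂ 2 μ} (hf : BddBy C f) : BddBy C (conjL2 f) := by
  filter_upwards [hf, coeFn_conjL2 f] with x h1 h2
  rw [h2, norm_star]
  exact h1

variable [IsProbabilityMeasure μ]

theorem coeFn_one : (one μ : X → ℂ) =ᵐ[μ] fun _ => 1 :=
  Lp.coeFn_const ..

theorem bddBy_one : BddBy 1 (one μ) := by
  filter_upwards [coeFn_one (μ := μ)] with x hx
  rw [hx, norm_one]

theorem mulBdd_one {f : Lp ℂ 2 μ} : mulBdd (one μ) f = f := by
  rw [mulBdd_eq_iff bddBy_one.isBdd]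
  filter_upwards [coeFn_one (μ := μ)] with x hx
  rw [hx, one_mul]

variable {V : Lp ℂ 2 μ →L[ℂ] Lp ℂ 2 μ} {T : X → X} {ψ : X → ℂ}

theorem ae_eq_weight (hT : MeasurePreserving T μ μ)
    (hV : ∀ f : Lp ℂ 2 μ, V f =ᵐ[μ] fun x => ψ x * f (T x)) : V (one μ) =ᵐ[μ] ψ := by
  filter_upwards [hV (one μ), hT.quasiMeasurePreserving.ae_eq_comp (coeFn_one (μ := μ))]
    with x h1 h2
  rw [h1]
  simp only [Function.comp_apply] at h2
  rw [h2, mul_one]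

/-- With `S` inverse to `T`, the indicator `f` of `S ⁻¹' E` satisfies `f ∘ T = 1_E`. Isometry then
says that `‖V 1‖²` has integral `μ E` over every `E`. -/
theorem ae_norm_weight_eq_one (hT : MeasurePreserving T μ μ) (hTi : IsAEInvertible μ T)
    (hiso : ∀ f, ‖V f‖ = ‖f‖) (hV : ∀ f : Lp ℂ 2 μ, V f =ᵐ[μ] fun x => ψ x * f (T x)) :
    ∀ᵐ x ∂μ, ‖V (one μ) x‖ = 1 := by
  obtain ⟨S, hS, hST, -⟩ := hTi
  have hψ := ae_eq_weight hT hV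
  have hint : Integrable (fun x => ‖V (one μ) x‖ ^ 2) μ := (Lp.memLp _).integrable_norm_pow (by simp)
  have key : (fun x => ‖V (one μ) x‖ ^ 2) =ᵐ[μ] fun _ => (1 : ℝ) := by
    refine Integrable.ae_eq_of_forall_setIntegral_eq _ _ hint (integrable_const _) ?_
    intro E hE _
    have hSE : MeasurableSet (S ⁻¹' E) := hS hE
    set f : Lp ℂ 2 μ := indicatorConstLp 2 hSE (measure_ne_top μ _) 1 with hf
    have hfT : (fun x => f (T x)) =ᵐ[μ] E.indicator fun _ => 1 := by
      have h := hT.quasiMeasurePreserving.ae_eq_comp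
        (indicatorConstLp_coeFn (p := 2) (hs := hSE) (hμs := measure_ne_top μ _) (c := (1 : ℂ)))
      filter_upwards [h, hST] with x h1 h2
      simp only [Function.comp_apply, ← hf] at h1
      rw [h1]
      by_cases hx : x ∈ E <;> simp [Set.indicator, h2, hx]
    -- Nothing is known about `S` and `μ` directly; pull back by `T`, which preserves `μ`, and use
    -- `S ∘ T = id`.
    have hm : μ.real (S ⁻¹' E) = μ.real E := by
      rw [← hT.measureReal_preimage hSE.nullMeasurableSet]
      refine measureReal_congr ?_
      filter_upwards [hST] with x hx
      change (S (T x) ∈ E) = (x ∈ E)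
      rw [hx]
    have h1 : ‖V f‖ ^ 2 = ∫ x in E, ‖V (one μ) x‖ ^ 2 ∂μ := by
      rw [norm_sq_eq_integral, ← integral_indicator hE]
      refine integral_congr_ae ?_
      filter_upwards [hV f, hfT, hψ] with x h1 h2 h3
      rw [h1, h2]
      by_cases hx : x ∈ E <;> simp [hx, h3]
    have h2 : ‖f‖ ^ 2 = μ.real E := by
      rw [hf, norm_sq_eq_integral, ← hm, ← integral_indicator_one hSE]
      refine integral_congr_ae ?_
      filter_upwards [indicatorConstLp_coeFn (p := 2) (hs := hSE) (hμs := measure_ne_top μ _)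
        (c := (1 : ℂ))] with x h1
      rw [h1]
      by_cases hx : x ∈ S ⁻¹' E <;> simp [Set.indicator, hx]
    rw [← h1, hiso, h2]
    simp
  filter_upwards [key] with x hx
  exact (pow_eq_one_iff_of_nonneg (norm_nonneg _) two_ne_zero).1 hx

theorem bddBy_weighted {C : ℝ} {f : Lp ℂ 2 μ} (hT : MeasurePreserving T μ μ)
    (hV : ∀ f : Lp ℂ 2 μ, V f =ᵐ[μ] fun x => ψ x * f (T x))
    (h1 : ∀ᵐ x ∂μ, ‖V (one μ) x‖ = 1) (hf : BddBy C f) : BddBy C (V f) := by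
  filter_upwards [hV f, ae_eq_weight hT hV, h1, hT.quasiMeasurePreserving.ae hf]
    with x h1 h2 h3 h4
  rw [h1, ← h2, norm_mul, h3, one_mul]
  exact h4

/-- `V f * V g` carries `ψ²`, and the conjugate of the unimodular `ψ` removes one factor. -/
theorem weighted_mul {f g : Lp ℂ 2 μ} (hT : MeasurePreserving T μ μ)
    (hV : ∀ f : Lp ℂ 2 μ, V f =ᵐ[μ] fun x => ψ x * f (T x))
    (h1 : ∀ᵐ x ∂μ, ‖V (one μ) x‖ = 1) (hf : IsBdd f) :
    V (mulBdd f g) = mulBdd (conjL2 (V (one μ))) (mulBdd (V f) (V g)) := by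
  obtain ⟨C, -, hC⟩ := hf.exists_bddBy
  have hb1 : BddBy 1 (conjL2 (V (one μ))) := BddBy.conjL2 (h1.mono fun x hx => hx.le)
  symm
  rw [mulBdd_eq_iff hb1.isBdd]
  filter_upwards [hV f, hV g, hV (mulBdd f g), ae_eq_weight hT hV, h1,
    hT.quasiMeasurePreserving.ae_eq_comp (coeFn_mulBdd hf g), coeFn_conjL2 (V (one μ)),
    coeFn_mulBdd (bddBy_weighted hT hV h1 hC).isBdd (V g)] with x h1 h2 h3 h4 h5 h6 h7 h8
  simp only [Function.comp_apply] at h6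
  have h9 : star (ψ x) * ψ x = 1 := by
    rw [← h4, Complex.star_def, Complex.conj_mul', h5]
    simp
  rw [h3, h6, h7, h8, h1, h2, h4]
  linear_combination (-ψ x * f (T x) * g (T x)) * h9

end Weighted

/-! ### From multiplicativity to the Leibniz rule -/

section Derivation

variable {X : Type*} [MeasurableSpace X] {μ : Measure X} [IsProbabilityMeasure μ]
  {U : ℝ → (Lp ℂ 2 μ →L[ℂ] Lp ℂ 2 μ)}

/-- On bounded functions, every `U t` is the composition of a multiplicative contraction with
multiplication by the unimodular function `U t 1`. -/
structure IsWeightedMul (U : ℝ → (Lp ℂ 2 μ →L[ℂ] Lp ℂ 2 μ)) : Prop where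
  norm_one : ∀ t, ∀ᵐ x ∂μ, ‖U t (one μ) x‖ = 1
  bddBy : ∀ t C f, BddBy C f → BddBy C (U t f)
  map_mul : ∀ t f g, IsBdd f →
    U t (mulBdd f g) = mulBdd (conjL2 (U t (one μ))) (mulBdd (U t f) (U t g))

theorem IsUnitaryC0Group.isWeightedMul (hU : IsUnitaryC0Group U)
    (h : ∀ t : ℝ, ∃ (T : X → X) (ψ : X → ℂ),
        MeasurePreserving T μ μ ∧ IsAEInvertible μ T ∧
        ∀ f : Lp ℂ 2 μ, (U t f : X → ℂ) =ᵐ[μ] fun x => ψ x * f (T x)) : IsWeightedMul U := by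
  have h1 : ∀ t, ∀ᵐ x ∂μ, ‖U t (one μ) x‖ = 1 := fun t => by
    obtain ⟨T, ψ, hT, hTi, hV⟩ := h t
    exact ae_norm_weight_eq_one hT hTi (hU.norm_map t) hV
  refine ⟨h1, fun t C f hf => ?_, fun t f g hf => ?_⟩
  · obtain ⟨T, ψ, hT, hTi, hV⟩ := h t
    exact bddBy_weighted hT hV (h1 t) hf
  · obtain ⟨T, ψ, hT, hTi, hV⟩ := h t
    exact weighted_mul hT hV (h1 t) hf

/-- The product rule, applied twice to the right side of `map_mul`; sup bounds are preserved by `U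
t`, so all factors are uniformly bounded. -/
theorem IsWeightedMul.hasDerivAt (hU : IsUnitaryC0Group U) (hW : IsWeightedMul U)
    {f g a f' g' : Lp ℂ 2 μ}
    (hf : IsBdd f) (hg : IsBdd g) (h1 : HasDerivAt (fun t => U t (one μ)) a 0)
    (hf' : HasDerivAt (fun t => U t f) f' 0) (hg' : HasDerivAt (fun t => U t g) g' 0) :
    HasDerivAt (fun t => U t (mulBdd f g))
      (mulBdd f g' + mulBdd g f' + mulBdd (mulBdd f g) (conjL2 a)) 0 := by
  obtain ⟨C, -, hC⟩ := hf.exists_bddBy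
  obtain ⟨C', -, hC'⟩ := hg.exists_bddBy
  have hb1 : ∀ t, BddBy 1 (conjL2 (U t (one μ))) :=
    fun t => (hW.bddBy t 1 _ bddBy_one).conjL2
  have hs : HasDerivAt (fun t => conjL2 (U t (one μ))) (conjL2 a) 0 := conjL2.hasFDerivAt.comp_hasDerivAt 0 h1
  have e1 := hasDerivAt_mulBdd hf' hg' (.of_forall fun t => hW.bddBy t C f hC)
    (.of_forall fun t => hW.bddBy t C' g hC')
  have e2 := hasDerivAt_mulBdd hs e1 (.of_forall hb1)
    (.of_forall fun t => (hW.bddBy t C f hC).mulBdd (hW.bddBy t C' g hC'))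
  have hst : conjL2 (one μ) = one μ := by
    refine Lp.ext ?_
    filter_upwards [coeFn_conjL2 (one μ), coeFn_one (μ := μ)] with x h1 h2
    rw [h1, h2, star_one]
  simp only [hU.apply_zero, hst, mulBdd_one, ← hW.map_mul _ f g hf] at e2
  exact e2

/-- Taking `f = g = 1` in `IsWeightedMul.hasDerivAt` gives `a + a + conj a = a`. -/
theorem IsWeightedMul.star_generator_one (hU : IsUnitaryC0Group U) (hW : IsWeightedMul U)
    {a : Lp ℂ 2 μ} (h1 : HasDerivAt (fun t => U t (one μ)) a 0) : conjL2 a = -a := by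
  have h := hW.hasDerivAt hU bddBy_one.isBdd bddBy_one.isBdd h1 h1 h1
  simp only [mulBdd_one] at h
  have := h.unique h1
  rw [add_assoc, add_eq_left] at this
  rwa [eq_neg_iff_add_eq_zero, add_comm]

theorem generator_sub_apply (h1 : one μ ∈ (generator U).domain)
    (hA1 : IsBdd (generator U ⟨one μ, h1⟩))
    (f : (generator U - (mulOp (MemLp.toLp _ hA1) : Lp ℂ 2 μ →ₗ[ℂ] Lp ℂ 2 μ).toPMap ⊤).domain) :
    (generator U - (mulOp (MemLp.toLp _ hA1) : Lp ℂ 2 μ →ₗ[ℂ] Lp ℂ 2 μ).toPMap ⊤) f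
      = generator U ⟨f, f.2.1⟩ - mulBdd (generator U ⟨one μ, h1⟩) f := by
  rw [LinearPMap.sub_apply, mulBdd, dif_pos hA1]
  rfl

theorem IsWeightedMul.isAlgebra_and_isDerivationOn (hU : IsUnitaryC0Group U) (hW : IsWeightedMul U)
    (h1 : one μ ∈ (generator U).domain) (hA1 : IsBdd (generator U ⟨one μ, h1⟩)) :
    IsAlgebra (interBdd (generator U).domain) ∧
      IsDerivationOn
        (generator U - (mulOp (MemLp.toLp _ hA1) : Lp ℂ 2 μ →ₗ[ℂ] Lp ℂ 2 μ).toPMap ⊤)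
        (interBdd (generator U).domain) := by
  have key : ∀ f g : (generator U).domain, IsBdd (f : Lp ℂ 2 μ) → IsBdd (g : Lp ℂ 2 μ) → _ :=
    fun f g hf hg => hW.hasDerivAt hU hf hg (hasDerivAt_generator ⟨one μ, h1⟩)
      (hasDerivAt_generator f) (hasDerivAt_generator g)
  refine ⟨fun f hf g hg => ⟨mulBdd f g, ⟨?_, hf.2.mulBdd hg.2⟩, coeFn_mulBdd hf.2 g⟩, ?_, ?_⟩
  · exact (key ⟨f, hf.1⟩ ⟨g, hg.1⟩ hf.2 hg.2).differentiableAt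
  · exact fun f hf => ⟨hf.1, trivial⟩
  · intro f g h hf hg hh hfg
    have hfg' : mulBdd (f : Lp ℂ 2 μ) g = h := (mulBdd_eq_iff hf.2).2 hfg
    have hd := key ⟨f, hf.1⟩ ⟨g, hg.1⟩ hf.2 hg.2
    have hgen := generator_eq (hfg' ▸ hd) hh.1
    rw [hW.star_generator_one hU (hasDerivAt_generator ⟨one μ, h1⟩)] at hgen
    rw [generator_sub_apply, generator_sub_apply, generator_sub_apply, hgen]
    exact coeFn_derivation hf.2 hg.2 hA1 hfg' _ _

end Derivation

/-! ### Skewness of the generator and uniqueness for `R' = AR + aR` -/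

section Generator

variable {X : Type*} [MeasurableSpace X] {μ : Measure X}
  {U : ℝ → (Lp ℂ 2 μ →L[ℂ] Lp ℂ 2 μ)}

theorem IsUnitaryC0Group.hasDerivAt_map (hU : IsUnitaryC0Group U) {f f' : Lp ℂ 2 μ} (s : ℝ)
    (h : HasDerivAt (fun t => U t f) f' 0) : HasDerivAt (fun t => U t (U s f)) (U s f') 0 := by
  have := ((U s).restrictScalars ℝ).hasFDerivAt.comp_hasDerivAt 0 h
  refine this.congr_of_eventuallyEq (.of_forall fun t => ?_)
  simp only [Function.comp_apply, ContinuousLinearMap.coe_restrictScalars']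
  rw [← hU.apply_add, ← hU.apply_add, add_comm]

theorem IsUnitaryC0Group.hasDerivAt_orbit (hU : IsUnitaryC0Group U) {f f' : Lp ℂ 2 μ} (s : ℝ)
    (h : HasDerivAt (fun t => U t f) f' 0) : HasDerivAt (fun t => U t f) (U s f') s := by
  have h1 : HasDerivAt (fun t => U t (U s f)) (U s f') (s - s) := by
    rw [sub_self]
    exact hU.hasDerivAt_map s h
  have h2 := h1.comp_sub_const s s
  refine h2.congr_of_eventuallyEq (.of_forall fun t => ?_)
  simp only
  rw [← hU.apply_add, sub_add_cancel]

/-- `‖U t f‖²` is constant in `t`. -/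
theorem IsUnitaryC0Group.inner_generator (hU : IsUnitaryC0Group U) {f f' : Lp ℂ 2 μ}
    (h : HasDerivAt (fun t => U t f) f' 0) : inner ℝ f f' = 0 := by
  have h1 := h.norm_sq
  simp only [hU.norm_map, hU.apply_zero] at h1
  have := h1.unique (hasDerivAt_const (0 : ℝ) _)
  linarith

theorem eq_zero_of_abs_deriv_le {u u' : ℝ → ℝ} {K : ℝ} (hu : ∀ t, HasDerivAt u (u' t) t)
    (hK : ∀ t, |u' t| ≤ K * |u t|) (h0 : u 0 = 0) (t : ℝ) : u t = 0 := by
  have key : ∀ v v' : ℝ → ℝ, (∀ t, HasDerivAt v (v' t) t) → (∀ t, |v' t| ≤ K * |v t|) →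
      v 0 = 0 → ∀ t, 0 ≤ t → v t = 0 := by
    intro v v' hv hvK hv0 t ht
    have := norm_le_gronwallBound_of_norm_deriv_right_le (f := v) (f' := v') (δ := 0) (K := K)
      (ε := 0) (a := 0) (b := t) (fun x _ => (hv x).continuousAt.continuousWithinAt)
      (fun x _ => (hv x).hasDerivWithinAt) (by simp [hv0])
      (fun x _ => by simpa using hvK x) t ⟨ht, le_rfl⟩
    rw [gronwallBound_ε0_δ0] at this
    exact norm_le_zero_iff.1 this
  rcases le_total 0 t with ht | ht
  · exact key u u' hu hK h0 t ht
  · have := key (fun s => u (-s)) (fun s => -u' (-s))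
      (fun s => by
        have h := (hu (-s)).comp s (hasDerivAt_neg s)
        rwa [mul_neg_one] at h)
      (fun s => by simpa using hK (-s)) (by simpa using h0) (-t) (by linarith)
    simpa using this

/-- In the derivative `2⟨R, AR + aR⟩` of `‖R‖²` the term with `A` vanishes by skewness, leaving at
most `2K‖R‖²`; Gronwall concludes. -/
theorem IsUnitaryC0Group.eq_zero_of_hasDerivAt (hU : IsUnitaryC0Group U) {R AR : ℝ → Lp ℂ 2 μ}
    {a : Lp ℂ 2 μ} (ha : IsBdd a) (hA : ∀ s, HasDerivAt (fun t => U t (R s)) (AR s) 0)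
    (hR : ∀ s, HasDerivAt R (AR s + mulBdd a (R s)) s) (h0 : R 0 = 0) (t : ℝ) : R t = 0 := by
  obtain ⟨K, hK, haK⟩ := ha.exists_bddBy
  have h := eq_zero_of_abs_deriv_le (u := fun s => ‖R s‖ ^ 2) (K := 2 * K)
    (fun s => (hR s).norm_sq) (fun s => ?_) (by simp [h0]) t
  · simpa using h
  · rw [inner_add_right, hU.inner_generator (hA s), zero_add, abs_mul, abs_two, mul_assoc,
      abs_of_nonneg (by positivity : 0 ≤ ‖R s‖ ^ 2)]
    gcongr
    calc _ ≤ ‖R s‖ * ‖mulBdd a (R s)‖ := abs_real_inner_le_norm _ _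
      _ ≤ ‖R s‖ * (K * ‖R s‖) := by gcongr; exact norm_mulBdd_le haK _
      _ = K * ‖R s‖ ^ 2 := by ring

end Generator

/-! ### Locally bounded orbits and density of `D(A) ∩ L_∞` -/

section LocallyBounded

variable {X : Type*} [MeasurableSpace X] {μ : Measure X} [IsProbabilityMeasure μ]
  {U : ℝ → (Lp ℂ 2 μ →L[ℂ] Lp ℂ 2 μ)}

/-- The inclusion of `L_∞(X)` in `L₂(X)`. -/
noncomputable def topToTwo : Lp ℂ ∞ μ →L[ℂ] Lp ℂ 2 μ :=
  ((ContinuousLinearMap.mul ℂ ℂ).holderL μ ∞ 2 2).flip (one μ)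

theorem coeFn_topToTwo (f : Lp ℂ ∞ μ) : topToTwo f =ᵐ[μ] f := by
  have h : topToTwo f =ᵐ[μ] fun x => f x * one μ x := coeFn_mulOp f (one μ)
  filter_upwards [h, coeFn_one (μ := μ)] with x h1 h2
  rw [h1, h2, mul_one]

theorem isBdd_topToTwo (f : Lp ℂ ∞ μ) : IsBdd (topToTwo f) :=
  (Lp.memLp f).ae_eq (coeFn_topToTwo f).symm

theorem topToTwo_toLp {f : Lp ℂ 2 μ} (hf : IsBdd f) : topToTwo (MemLp.toLp f hf) = f :=
  Lp.ext ((coeFn_topToTwo _).trans (MemLp.coeFn_toLp hf))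

omit [IsProbabilityMeasure μ] in
theorem IsUnitaryC0Group.continuous_uncurry (hU : IsUnitaryC0Group U) :
    Continuous fun p : ℝ × Lp ℂ 2 μ => U p.1 p.2 := by
  refine continuous_iff_continuousAt.2 fun ⟨t, f⟩ => ?_
  have h1 : Tendsto (fun p : ℝ × Lp ℂ 2 μ => U p.1 f) (𝓝 (t, f)) (𝓝 (U t f)) :=
    ((hU.continuous f).comp continuous_fst).tendsto (t, f)
  have h2 : Tendsto (fun p : ℝ × Lp ℂ 2 μ => U p.1 (p.2 - f)) (𝓝 (t, f)) (𝓝 0) := by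
    rw [tendsto_zero_iff_norm_tendsto_zero]
    simp only [hU.norm_map]
    have : Continuous fun p : ℝ × Lp ℂ 2 μ => ‖p.2 - f‖ := by fun_prop
    simpa using this.tendsto (t, f)
  have h3 := h1.add h2
  simp only [map_sub, add_sub_cancel, add_zero] at h3
  exact h3

/-- Baire's theorem on `ℝ × L_∞`: the closed sets `F n` cover it, so one contains a ball about some
`(t₀, f₀)`. Differences of points of the ball give bounds on `U (t₀ + t)` near zero, and composing
with `U (-t₀)` moves `t₀` to `0`. -/
theorem IsUnitaryC0Group.exists_bddBy_orbit (hU : IsUnitaryC0Group U)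
    (hbdd : ∀ (t : ℝ) (f : Lp ℂ 2 μ), IsBdd f → IsBdd (U t f)) :
    ∃ δ > 0, ∀ f, IsBdd f → ∃ C, ∀ t : ℝ, |t| < δ → BddBy C (U t f) := by
  obtain ⟨F, hF⟩ : ∃ F : ℕ → Set (ℝ × Lp ℂ ∞ μ),
      ∀ n p, p ∈ F n ↔ BddBy n (U p.1 (topToTwo p.2)) :=
    ⟨fun n => {p | BddBy n (U p.1 (topToTwo p.2))}, fun _ _ => Iff.rfl⟩
  have hFc : ∀ n, IsClosed (F n) := fun n => by
    have h := (isClosed_bddBy (n : ℝ)).preimage (hU.continuous_uncurry.comp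
      (continuous_fst.prodMk ((topToTwo (μ := μ)).continuous.comp continuous_snd)))
    convert h using 1
    exact Set.ext (hF n)
  have hcover : ⋃ n, F n = Set.univ := by
    refine Set.eq_univ_of_forall fun p => ?_
    obtain ⟨C, -, hC⟩ := (hbdd p.1 _ (isBdd_topToTwo p.2)).exists_bddBy
    obtain ⟨n, hn⟩ := exists_nat_ge C
    exact Set.mem_iUnion.2 ⟨n, (hF n p).2 (hC.mono hn)⟩
  obtain ⟨n, ⟨t₀, f₀⟩, hp⟩ := nonempty_interior_of_iUnion_of_closed hFc hcover
  obtain ⟨ε, hε, hball⟩ := Metric.isOpen_iff.1 isOpen_interior _ hp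
  refine ⟨ε, hε, fun f hf => ?_⟩
  obtain ⟨G, hGf⟩ : ∃ G : Lp ℂ ∞ μ, topToTwo G = U (-t₀) f := ⟨_, topToTwo_toLp (hbdd (-t₀) f hf)⟩
  -- The scaling puts `f₀ + c • G` in the ball; the `+ 1` allows `G = 0`.
  set c : ℝ := ε / (2 * (‖G‖ + 1)) with hc
  have hc0 : 0 < c := by positivity
  have hcG : ‖(c : ℂ) • G‖ < ε := by
    rw [norm_smul, Complex.norm_real, Real.norm_of_nonneg hc0.le]
    calc c * ‖G‖ ≤ c * (‖G‖ + 1) := by gcongr; linarith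
      _ = ε / 2 := by rw [hc]; field_simp
      _ < ε := by linarith
  refine ⟨‖(c : ℂ)⁻¹‖ * (n + n), fun t ht => ?_⟩
  have m1 : BddBy n (U (t₀ + t) (topToTwo (f₀ + (c : ℂ) • G))) := by
    refine (hF n (t₀ + t, f₀ + (c : ℂ) • G)).1 (interior_subset (hball ?_))
    rw [Metric.mem_ball, Prod.dist_eq, dist_eq_norm, dist_eq_norm, add_sub_cancel_left,
      add_sub_cancel_left]
    exact max_lt ht hcG
  have m2 : BddBy n (U (t₀ + t) (topToTwo f₀)) := by
    refine (hF n (t₀ + t, f₀)).1 (interior_subset (hball ?_))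
    rw [Metric.mem_ball, Prod.dist_eq, dist_eq_norm, dist_self, add_sub_cancel_left]
    exact max_lt ht hε
  have m3 := (m1.sub m2).smul (c : ℂ)⁻¹
  rwa [← map_sub, ← map_sub, add_sub_cancel_left, map_smul, map_smul, smul_smul,
    inv_mul_cancel₀ (by exact_mod_cast hc0.ne'), one_smul, hGf, ← hU.apply_add,
    add_right_comm, add_neg_cancel, zero_add] at m3

theorem IsUnitaryC0Group.eventually_bddBy (hU : IsUnitaryC0Group U)
    (hbdd : ∀ (t : ℝ) (f : Lp ℂ 2 μ), IsBdd f → IsBdd (U t f)) {f : Lp ℂ 2 μ} (hf : IsBdd f)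
    (s : ℝ) : ∃ C, ∀ᶠ t in 𝓝 s, BddBy C (U t f) := by
  obtain ⟨δ, hδ, h⟩ := hU.exists_bddBy_orbit hbdd
  obtain ⟨C, hC⟩ := h _ (hbdd s f hf)
  refine ⟨C, Metric.eventually_nhds_iff.2 ⟨δ, hδ, fun t ht => ?_⟩⟩
  have := hC (t - s) ht
  rwa [← hU.apply_add, sub_add_cancel] at this

omit [IsProbabilityMeasure μ] in
-- `U t` shifts the interval of integration to `[t, t + ε]`, so only the endpoints contribute.
theorem IsUnitaryC0Group.hasDerivAt_integral (hU : IsUnitaryC0Group U) (f : Lp ℂ 2 μ) (ε : ℝ) :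
    HasDerivAt (fun t => U t (∫ s in (0 : ℝ)..ε, U s f)) (U ε f - f) 0 := by
  have hcont := hU.continuous f
  have hi : ∀ a b, IntervalIntegrable (fun s => U s f) volume a b :=
    fun a b => hcont.intervalIntegrable a b
  have h1 : ∀ t, U t (∫ s in (0 : ℝ)..ε, U s f)
      = (∫ s in (0 : ℝ)..(t + ε), U s f) - ∫ s in (0 : ℝ)..t, U s f := by
    intro t
    rw [← ContinuousLinearMap.intervalIntegral_comp_comm _ (hi _ _)]
    simp only [← hU.apply_add]
    rw [intervalIntegral.integral_comp_add_left (fun s => U s f), add_zero,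
      intervalIntegral.integral_interval_sub_left (hi _ _) (hi _ _)]
  simp only [h1]
  have h2 : ∀ t, HasDerivAt (fun x => ∫ s in (0 : ℝ)..x, U s f) (U t f) t := fun t =>
    intervalIntegral.integral_hasDerivAt_right (hi _ _)
      (hcont.stronglyMeasurableAtFilter _ _) hcont.continuousAt
  have h3 : HasDerivAt (fun t => ∫ s in (0 : ℝ)..(t + ε), U s f) (U ε f) 0 := by
    have := (h2 (0 + ε)).comp_add_const 0 ε
    rwa [zero_add] at this
  have h4 := h3.sub (h2 0)
  rw [hU.apply_zero] at h4
  exact h4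

/-- For bounded `f`, the averages of `U s f` over `[0, ε]` tend to `f` and lie in the domain. They
are bounded, because the classes bounded by `C` form a closed convex set. -/
theorem IsUnitaryC0Group.dense_interBdd (hU : IsUnitaryC0Group U)
    (hbdd : ∀ (t : ℝ) (f : Lp ℂ 2 μ), IsBdd f → IsBdd (U t f)) :
    Dense (interBdd (generator U).domain : Set (Lp ℂ 2 μ)) := by
  suffices h : {f : Lp ℂ 2 μ | IsBdd f} ⊆ closure (interBdd (generator U).domain) from
    fun f => closure_minimal h isClosed_closure (dense_isBdd f)
  intro f hf
  obtain ⟨δ, hδ, h⟩ := hU.exists_bddBy_orbit hbdd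
  obtain ⟨C, hC⟩ := h f hf
  have hcont := hU.continuous f
  have hder : HasDerivAt (fun x => ∫ s in (0 : ℝ)..x, U s f) f 0 := by
    have := intervalIntegral.integral_hasDerivAt_right (hcont.intervalIntegrable 0 0)
      (hcont.stronglyMeasurableAtFilter _ _) hcont.continuousAt
    rwa [hU.apply_zero] at this
  have hlim := (hasDerivAt_iff_tendsto_slope.1 hder).mono_left
    (nhdsWithin_mono 0 (fun x (hx : x ∈ Set.Ioi 0) => (Set.mem_Ioi.1 hx).ne'))
  refine mem_closure_of_tendsto hlim ?_
  filter_upwards [Ioo_mem_nhdsGT hδ] with ε hε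
  rw [slope_def_module, intervalIntegral.integral_same, sub_zero, sub_zero]
  constructor
  · have h1 := (hU.hasDerivAt_integral f ε).const_smul ε⁻¹
    refine DifferentiableAt.congr_of_eventuallyEq h1.differentiableAt (.of_forall fun t => ?_)
    exact ContinuousLinearMap.map_smul_of_tower _ _ _
  · refine BddBy.isBdd (C := C) ?_
    have h2 := (convex_bddBy (μ := μ) C).set_average_mem (μ := volume) (t := Set.Ioc 0 ε)
      (f := fun s => U s f) (isClosed_bddBy C) (by simpa using hε.1) (by simp)
      ((ae_restrict_mem measurableSet_Ioc).mono fun s hs => hC s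
        (by rw [abs_of_pos hs.1]; exact hs.2.trans_lt hε.2))
      ((hcont.integrableOn_Icc (a := 0) (b := ε)).mono_set Set.Ioc_subset_Icc_self)
    rw [← Set.uIoc_of_le hε.1.le, interval_average_eq, sub_zero] at h2
    exact h2

end LocallyBounded

/-! ### From the Leibniz rule to multiplicativity -/

section Multiplicative

variable {X : Type*} [MeasurableSpace X] {μ : Measure X} [IsProbabilityMeasure μ]
  {U : ℝ → (Lp ℂ 2 μ →L[ℂ] Lp ℂ 2 μ)}

theorem hasDerivAt_mulBdd_of_isDerivationOn (h1 : one μ ∈ (generator U).domain)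
    (hA1 : IsBdd (generator U ⟨one μ, h1⟩)) (halg : IsAlgebra (interBdd (generator U).domain))
    (hder : IsDerivationOn
        (generator U - (mulOp (MemLp.toLp _ hA1) : Lp ℂ 2 μ →ₗ[ℂ] Lp ℂ 2 μ).toPMap ⊤)
        (interBdd (generator U).domain))
    {f g f' g' : Lp ℂ 2 μ} (hf : IsBdd f) (hg : IsBdd g)
    (hf' : HasDerivAt (fun t => U t f) f' 0) (hg' : HasDerivAt (fun t => U t g) g' 0) :
    HasDerivAt (fun t => U t (mulBdd f g))
      (mulBdd f g' + mulBdd g f' - mulBdd (generator U ⟨one μ, h1⟩) (mulBdd f g)) 0 := by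
  have hfd : f ∈ (generator U).domain := hf'.differentiableAt
  have hgd : g ∈ (generator U).domain := hg'.differentiableAt
  obtain ⟨h, hh, hfg⟩ := halg f ⟨hfd, hf⟩ g ⟨hgd, hg⟩
  have hfg' := (mulBdd_eq_iff hf).2 hfg
  have hd := hder.2 ⟨f, hfd, trivial⟩ ⟨g, hgd, trivial⟩ ⟨h, hh.1, trivial⟩ ⟨hfd, hf⟩ ⟨hgd, hg⟩ hh hfg
  rw [generator_sub_apply, generator_sub_apply, generator_sub_apply,
    generator_eq hf' hfd, generator_eq hg' hgd] at hd
  have e := coeFn_derivation hf hg hA1 hfg' f' g'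
  have e2 := Lp.ext (hd.trans e.symm)
  rw [sub_left_inj] at e2
  have e3 := hasDerivAt_generator (U := U) ⟨h, hh.1⟩
  rw [e2] at e3
  rw [hfg', sub_eq_add_neg, mulBdd_comm hA1 hh.2, ← map_neg]
  exact e3

/-- Both sides solve `R' = AR + aR` and equal `fg` at time `0`, at least for `f`, `g` in `D(A) ∩
L_∞`; density does the rest. -/
theorem IsUnitaryC0Group.mulBdd_map_map (hU : IsUnitaryC0Group U)
    (hbdd : ∀ (t : ℝ) (f : Lp ℂ 2 μ), IsBdd f → IsBdd (U t f))
    {a : Lp ℂ 2 μ} (ha : IsBdd a) (h1 : HasDerivAt (fun t => U t (one μ)) a 0)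
    (hder : ∀ f g f' g' : Lp ℂ 2 μ, IsBdd f → IsBdd g → HasDerivAt (fun t => U t f) f' 0 →
      HasDerivAt (fun t => U t g) g' 0 → HasDerivAt (fun t => U t (mulBdd f g))
        (mulBdd f g' + mulBdd g f' - mulBdd a (mulBdd f g)) 0)
    {f g : Lp ℂ 2 μ} (hf : IsBdd f) (t : ℝ) :
    mulBdd (U t f) (U t g) = mulBdd (U t (one μ)) (U t (mulBdd f g)) := by
  have prod : ∀ f g f' g' : Lp ℂ 2 μ, IsBdd f → IsBdd g → HasDerivAt (fun t => U t f) f' 0 →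
      HasDerivAt (fun t => U t g) g' 0 → ∃ AR : ℝ → Lp ℂ 2 μ,
        (∀ s, HasDerivAt (fun t => U t (mulBdd (U s f) (U s g))) (AR s) 0) ∧
        ∀ s, HasDerivAt (fun t => mulBdd (U t f) (U t g))
          (AR s + mulBdd a (mulBdd (U s f) (U s g))) s := by
    intro f g f' g' hf hg hf' hg'
    refine ⟨_, fun s => hder _ _ _ _ (hbdd s f hf) (hbdd s g hg) (hU.hasDerivAt_map s hf')
      (hU.hasDerivAt_map s hg'), fun s => ?_⟩
    obtain ⟨C, hC⟩ := hU.eventually_bddBy hbdd hf s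
    obtain ⟨C', hC'⟩ := hU.eventually_bddBy hbdd hg s
    -- The term `-a (U s f)(U s g)` in `AR s` cancels, and the ordinary product rule remains.
    rw [sub_add_cancel]
    exact hasDerivAt_mulBdd (hU.hasDerivAt_orbit s hf') (hU.hasDerivAt_orbit s hg') hC hC'
  have core : ∀ f ∈ interBdd (generator U).domain, ∀ g ∈ interBdd (generator U).domain,
      mulBdd (U t f) (U t g) = mulBdd (U t (one μ)) (U t (mulBdd f g)) := by
    rintro f ⟨hfd, hf⟩ g ⟨hgd, hg⟩
    have hf' := hasDerivAt_generator (U := U) ⟨f, hfd⟩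
    have hg' := hasDerivAt_generator (U := U) ⟨g, hgd⟩
    obtain ⟨P, hP, hP'⟩ := prod f g _ _ hf hg hf' hg'
    obtain ⟨Q, hQ, hQ'⟩ := prod (one μ) (mulBdd f g) _ _ bddBy_one.isBdd (hf.mulBdd hg) h1
      (hder _ _ _ _ hf hg hf' hg')
    have := hU.eq_zero_of_hasDerivAt (AR := fun s => P s - Q s)
      (R := fun s => mulBdd (U s f) (U s g) - mulBdd (U s (one μ)) (U s (mulBdd f g))) ha
      (fun s => by simpa only [map_sub] using (hP s).fun_sub (hQ s))
      (fun s => by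
        have h := (hP' s).fun_sub (hQ' s)
        rwa [add_sub_add_comm, ← map_sub] at h)
      (by simp only [hU.apply_zero, mulBdd_one, sub_self]) t
    exact sub_eq_zero.1 this
  have hdense := hU.dense_interBdd hbdd
  -- For a fixed bounded `f` both sides are continuous in `g`, so the factors are freed one at a
  -- time, with a swap in between.
  have step : ∀ f ∈ interBdd (generator U).domain, ∀ g : Lp ℂ 2 μ,
      mulBdd (U t f) (U t g) = mulBdd (U t (one μ)) (U t (mulBdd f g)) := by
    intro f hf g
    have := Continuous.ext_on hdense ((mulBdd (U t f)).comp (U t)).continuous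
      ((mulBdd (U t (one μ))).comp ((U t).comp (mulBdd f))).continuous (fun g hg => core f hf g hg)
    exact congrFun this g
  have step' : ∀ g ∈ interBdd (generator U).domain,
      mulBdd (U t f) (U t g) = mulBdd (U t (one μ)) (U t (mulBdd f g)) := by
    intro g hg
    rw [mulBdd_comm (hbdd t f hf) (hbdd t g hg.2), mulBdd_comm hf hg.2]
    exact step g hg f
  have := Continuous.ext_on hdense ((mulBdd (U t f)).comp (U t)).continuous
      ((mulBdd (U t (one μ))).comp ((U t).comp (mulBdd f))).continuous step'
  exact congrFun this g

end Multiplicative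

/-! ### Indicator functions as classes in `L₂` -/

section Indicator

variable {X : Type*} [MeasurableSpace X] {μ : Measure X} [IsProbabilityMeasure μ]

open Classical in
/-- The class of the indicator function of a measurable set `s`; it is `0` if `s` is not
measurable. -/
noncomputable def ind (μ : Measure X) [IsProbabilityMeasure μ] (s : Set X) : Lp ℂ 2 μ :=
  if hs : MeasurableSet s then indicatorConstLp 2 hs (measure_ne_top μ s) 1 else 0

theorem coeFn_ind {s : Set X} (hs : MeasurableSet s) :
    ind μ s =ᵐ[μ] s.indicator fun _ => 1 := by
  rw [ind, dif_pos hs]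
  exact indicatorConstLp_coeFn

theorem isBdd_ind {s : Set X} (hs : MeasurableSet s) : IsBdd (ind μ s) := by
  rw [ind, dif_pos hs]
  exact isBdd_indicatorConstLp hs _ _

theorem norm_ind_sq {s : Set X} (hs : MeasurableSet s) : ‖ind μ s‖ ^ 2 = μ.real s := by
  rw [norm_sq_eq_integral, ← integral_indicator_one hs]
  refine integral_congr_ae ?_
  filter_upwards [coeFn_ind (μ := μ) hs] with x h1
  rw [h1]
  by_cases hx : x ∈ s <;> simp [hx]

theorem eq_ind_iff {s : Set X} (hs : MeasurableSet s) {f : Lp ℂ 2 μ} :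
    f = ind μ s ↔ f =ᵐ[μ] s.indicator fun _ => 1 :=
  ⟨fun h => h ▸ coeFn_ind hs, fun h => Lp.ext (h.trans (coeFn_ind hs).symm)⟩

theorem ind_empty : ind μ (∅ : Set X) = 0 := by
  symm
  rw [eq_ind_iff MeasurableSet.empty, Set.indicator_empty]
  exact Lp.coeFn_zero ..

theorem ind_compl {s : Set X} (hs : MeasurableSet s) : ind μ sᶜ = one μ - ind μ s := by
  symm
  rw [eq_ind_iff hs.compl]
  filter_upwards [coeFn_ind (μ := μ) hs, Lp.coeFn_sub (one μ) (ind μ s), coeFn_one (μ := μ)]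
    with x h1 h2 h3
  rw [h2, Pi.sub_apply, h1, h3]
  by_cases hx : x ∈ s <;> simp [hx]

theorem ind_inter {s t : Set X} (hs : MeasurableSet s) (ht : MeasurableSet t) :
    ind μ (s ∩ t) = mulBdd (ind μ s) (ind μ t) := by
  symm
  rw [eq_ind_iff (hs.inter ht)]
  filter_upwards [coeFn_ind (μ := μ) hs, coeFn_ind (μ := μ) ht,
    coeFn_mulBdd (isBdd_ind hs) (ind μ t)] with x h1 h2 h3
  rw [h3, h1, h2]
  by_cases hx : x ∈ s <;> by_cases hx' : x ∈ t <;> simp [hx, hx']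

theorem tendsto_ind_iUnion {s : ℕ → Set X} (hs : ∀ n, MeasurableSet (s n)) (hmono : Monotone s) :
    Tendsto (fun n => ind μ (s n)) atTop (𝓝 (ind μ (⋃ n, s n))) := by
  have hU := MeasurableSet.iUnion hs
  simp only [ind, hs, hU, dif_pos]
  refine tendsto_indicatorConstLp_set (by simp) ?_
  have e : ∀ n, symmDiff (s n) (⋃ n, s n) = (⋃ n, s n) \ s n := fun n =>
    symmDiff_of_le (Set.subset_iUnion s n)
  simp only [e]
  have h := tendsto_measure_iInter_atTop (μ := μ) (s := fun n => (⋃ n, s n) \ s n)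
    (fun n => (hU.diff (hs n)).nullMeasurableSet)
    (fun m n hmn => Set.sdiff_subset_sdiff_right (hmono hmn)) ⟨0, measure_ne_top _ _⟩
  have h0 : ⋂ n, (⋃ n, s n) \ s n = ∅ := by
    rw [← Set.sdiff_iUnion, Set.sdiff_self]
  rwa [h0, measure_empty] at h

end Indicator

/-! ### Point maps inducing multiplicative isometries -/

section PointRealization

variable {X : Type*} [MeasurableSpace X] {μ : Measure X} [IsProbabilityMeasure μ]

/-- A multiplicative isometry of `L₂(X)` that fixes `1` and preserves `L_∞(X)`. -/
structure IsMulIsometry (W : Lp ℂ 2 μ →L[ℂ] Lp ℂ 2 μ) : Prop where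
  norm_map : ∀ f, ‖W f‖ = ‖f‖
  map_one : W (one μ) = one μ
  isBdd : ∀ f, IsBdd f → IsBdd (W f)
  map_mul : ∀ f g, IsBdd f → W (mulBdd f g) = mulBdd (W f) (W g)

variable {W : Lp ℂ 2 μ →L[ℂ] Lp ℂ 2 μ}

/-- The image of an idempotent is idempotent, hence takes only the values `0` and `1`. -/
theorem IsMulIsometry.exists_map_ind (hW : IsMulIsometry W) {s : Set X} (hs : MeasurableSet s) :
    ∃ t, MeasurableSet t ∧ W (ind μ s) = ind μ t := by
  have hm : MeasurableSet {x | W (ind μ s) x = 1} :=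
    (Lp.stronglyMeasurable (W (ind μ s))).measurable (measurableSet_singleton 1)
  refine ⟨{x | W (ind μ s) x = 1}, hm, ?_⟩
  rw [eq_ind_iff hm]
  have h : mulBdd (W (ind μ s)) (W (ind μ s)) = W (ind μ s) := by
    rw [← hW.map_mul _ _ (isBdd_ind hs), ← ind_inter hs hs, Set.inter_self]
  filter_upwards [(mulBdd_eq_iff (hW.isBdd _ (isBdd_ind hs))).1 h] with x hx
  by_cases hx1 : W (ind μ s) x = 1
  · simp [hx1]
  · rw [Set.indicator_of_notMem (by simpa using hx1)]
    rcases mul_eq_zero.1 (show W (ind μ s) x * (W (ind μ s) x - 1) = 0 by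
      linear_combination -hx) with h | h
    · exact h
    · exact absurd (sub_eq_zero.1 h) hx1

/-- Complements and products give finite unions; continuity of `W` along the partial unions gives
countable ones. -/
theorem IsMulIsometry.map_ind_iUnion (hW : IsMulIsometry W) {s t : ℕ → Set X}
    (hs : ∀ n, MeasurableSet (s n)) (ht : ∀ n, MeasurableSet (t n))
    (h : ∀ n, W (ind μ (s n)) = ind μ (t n)) : W (ind μ (⋃ n, s n)) = ind μ (⋃ n, t n) := by
  have hcompl : ∀ a b : Set X, MeasurableSet a → MeasurableSet b → W (ind μ a) = ind μ b →
      W (ind μ aᶜ) = ind μ bᶜ := fun a b ha hb hab => by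
    rw [ind_compl ha, ind_compl hb, map_sub, hW.map_one, hab]
  have hunion : ∀ a b a' b' : Set X, MeasurableSet a → MeasurableSet b → MeasurableSet a' →
      MeasurableSet b' → W (ind μ a) = ind μ b → W (ind μ a') = ind μ b' →
      W (ind μ (a ∪ a')) = ind μ (b ∪ b') := fun a b a' b' ha hb ha' hb' hab hab' => by
    rw [← compl_compl (a ∪ a'), ← compl_compl (b ∪ b'), Set.compl_union, Set.compl_union]
    refine hcompl _ _ (ha.compl.inter ha'.compl) (hb.compl.inter hb'.compl) ?_
    rw [ind_inter ha.compl ha'.compl, ind_inter hb.compl hb'.compl,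
      hW.map_mul _ _ (isBdd_ind ha.compl), hcompl a b ha hb hab, hcompl a' b' ha' hb' hab']
  have hms : ∀ n, MeasurableSet (Set.accumulate s n) := fun n =>
    .biUnion (Set.to_countable _) fun i _ => hs i
  have hmt : ∀ n, MeasurableSet (Set.accumulate t n) := fun n =>
    .biUnion (Set.to_countable _) fun i _ => ht i
  have hacc : ∀ n, W (ind μ (Set.accumulate s n)) = ind μ (Set.accumulate t n) := by
    intro n
    induction n with
    | zero => simpa using h 0
    | succ n ih =>
      rw [Set.accumulate_succ, Set.accumulate_succ]
      exact hunion _ _ _ _ (hms n) (hmt n) (hs _) (ht _) ih (h _)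
  have h1 := (W.continuous.tendsto _).comp
    (tendsto_ind_iUnion (μ := μ) hms Set.monotone_accumulate)
  have h2 := tendsto_ind_iUnion (μ := μ) hmt Set.monotone_accumulate
  simp only [Function.comp_def, hacc] at h1
  rw [← Set.iUnion_accumulate (s := s), ← Set.iUnion_accumulate (s := t)]
  exact tendsto_nhds_unique h1 h2

/-- If `c` is a random point of the Cantor space, then `W` transports its distribution to that
of another random point `G`. -/
theorem IsMulIsometry.exists_map_ind_preimage (hW : IsMulIsometry W) {c : X → ℕ → Bool}
    (hc : Measurable c) : ∃ G : X → ℕ → Bool, Measurable G ∧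
      ∀ E, MeasurableSet E → W (ind μ (c ⁻¹' E)) = ind μ (G ⁻¹' E) := by
  have hA : ∀ n, MeasurableSet {y : ℕ → Bool | y n = true} := fun n =>
    measurableSet_eq_fun (measurable_pi_apply n) measurable_const
  choose D hD hWD using fun n => hW.exists_map_ind (hc (hA n))
  classical
  -- The `n`-th coordinate of `G` records membership in the image under `W` of the `n`-th coordinate
  -- set of `c`.
  let G : X → ℕ → Bool := fun x n => decide (x ∈ D n)
  have hGpre : ∀ n, G ⁻¹' {y | y n = true} = D n := fun n => by
    ext x
    simp [G]
  have hG : Measurable G := by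
    refine measurable_pi_iff.2 fun n => measurable_to_bool ?_
    have : (fun x => G x n) ⁻¹' {true} = D n := hGpre n
    rw [this]
    exact hD n
  refine ⟨G, hG, ?_⟩
  -- The good sets `E` form a σ-algebra, so it is enough that it makes the coordinates measurable.
  let m : MeasurableSpace (ℕ → Bool) :=
    { MeasurableSet' := fun E => MeasurableSet E ∧ W (ind μ (c ⁻¹' E)) = ind μ (G ⁻¹' E)
      measurableSet_empty := ⟨.empty, by
        rw [Set.preimage_empty, Set.preimage_empty, ind_empty, map_zero]⟩
      measurableSet_compl := fun E hE => ⟨hE.1.compl, by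
        rw [Set.preimage_compl, Set.preimage_compl, ind_compl (hc hE.1), ind_compl (hG hE.1),
          map_sub, hW.map_one, hE.2]⟩
      measurableSet_iUnion := fun E hE => ⟨.iUnion fun n => (hE n).1, by
        rw [Set.preimage_iUnion, Set.preimage_iUnion]
        exact hW.map_ind_iUnion (fun n => hc (hE n).1) (fun n => hG (hE n).1)
          fun n => (hE n).2⟩ }
  have hle : MeasurableSpace.pi ≤ m := by
    refine iSup_le fun n => Measurable.comap_le (m₁ := m) ?_
    refine @measurable_to_bool _ m _ ⟨hA n, ?_⟩
    exact (hWD n).trans (congrArg (ind μ) (hGpre n).symm)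
  exact fun E hE => (hle E hE).2

theorem IsMulIsometry.eq_comp (hW : IsMulIsometry W) {T : X → X} (hT : Measurable T)
    (h : ∀ s, MeasurableSet s → W (ind μ s) = ind μ (T ⁻¹' s)) :
    MeasurePreserving T μ μ ∧ ∀ f : Lp ℂ 2 μ, W f =ᵐ[μ] f ∘ T := by
  have hmp : MeasurePreserving T μ μ := by
    refine ⟨hT, Measure.ext fun s hs => ?_⟩
    rw [Measure.map_apply hT hs, ← measureReal_eq_measureReal_iff, ← norm_ind_sq (hT hs),
      ← norm_ind_sq hs, ← h s hs, hW.norm_map]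
  refine ⟨hmp, fun f => ?_⟩
  suffices hf : W f = Lp.compMeasurePreservingₗᵢ ℂ T hmp f by
    rw [hf]
    exact Lp.coeFn_compMeasurePreserving f hmp
  refine Lp.induction (p := 2) (by simp)
    (motive := fun f => W f = Lp.compMeasurePreservingₗᵢ ℂ T hmp f) ?_ ?_ ?_ f
  · intro c s hs hμs
    have e : indicatorConstLp 2 hs hμs.ne c = c • ind μ s := by
      refine Lp.ext ?_
      filter_upwards [indicatorConstLp_coeFn (p := 2) (hs := hs) (hμs := hμs.ne) (c := c),
        Lp.coeFn_smul c (ind μ s), coeFn_ind (μ := μ) hs] with x h1 h2 h3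
      rw [h1, h2, Pi.smul_apply, h3]
      by_cases hx : x ∈ s <;> simp [hx]
    rw [Lp.simpleFunc.coe_indicatorConst, e, map_smul, map_smul, h s hs]
    congr 1
    symm
    rw [eq_ind_iff (hT hs)]
    exact (Lp.coeFn_compMeasurePreserving (ind μ s) hmp).trans
      (hmp.quasiMeasurePreserving.ae_eq_comp (coeFn_ind hs))
  · intro f g hf hg _ h1 h2
    rw [map_add, map_add, h1, h2]
  · exact isClosed_eq W.continuous (Lp.compMeasurePreservingₗᵢ ℂ T hmp).continuous

variable [StandardBorelSpace X]

/-- Embed `X` in the Cantor space by `c`. A measurable left inverse `g` of `c` gives `T = g ∘ G`,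
since every `s` is `c ⁻¹' (g ⁻¹' s)`. -/
theorem IsMulIsometry.exists_measurePreserving (hW : IsMulIsometry W) :
    ∃ T : X → X, MeasurePreserving T μ μ ∧ ∀ f : Lp ℂ 2 μ, W f =ᵐ[μ] f ∘ T := by
  obtain ⟨c, hc, hinj⟩ := MeasurableSpace.measurable_injection_nat_bool_of_countablySeparated X
  obtain ⟨G, hG, hWG⟩ := hW.exists_map_ind_preimage hc
  obtain ⟨g, hg, hgc⟩ := (hc.measurableEmbedding hinj).exists_measurable_extend measurable_id
    fun _ => nonempty_of_isProbabilityMeasure μ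
  refine ⟨g ∘ G, hW.eq_comp (hg.comp hG) fun s hs => ?_⟩
  have := hWG (g ⁻¹' s) (hg hs)
  rwa [← Set.preimage_comp, ← Set.preimage_comp, hgc, Set.preimage_id] at this

/-- Countably many coordinate sets separate points, so their exceptional null sets can be united. -/
theorem ae_eq_self_of_forall_comp_ae_eq {R : X → X} (hR : MeasurePreserving R μ μ)
    (h : ∀ f : Lp ℂ 2 μ, f ∘ R =ᵐ[μ] f) : ∀ᵐ x ∂μ, R x = x := by
  obtain ⟨c, hc, hinj⟩ := MeasurableSpace.measurable_injection_nat_bool_of_countablySeparated X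
  have hA : ∀ n, MeasurableSet {x | c x n = true} := fun n =>
    (measurable_pi_iff.1 hc n) (measurableSet_singleton true)
  have key : ∀ᵐ x ∂μ, ∀ n, c (R x) n = c x n := by
    refine ae_all_iff.2 fun n => ?_
    filter_upwards [h (ind μ {x | c x n = true}), coeFn_ind (μ := μ) (hA n),
      hR.quasiMeasurePreserving.ae_eq_comp (coeFn_ind (μ := μ) (hA n))] with x h1 h2 h3
    rw [h3, h2] at h1
    by_cases hx : c x n = true <;> by_cases hx' : c (R x) n = true <;>
      simp_all [Set.indicator]
  filter_upwards [key] with x hx using hinj (funext hx)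

/-- Dividing by the unimodular `V 1` turns `V` into a multiplicative isometry fixing `1`; the weight
is `V 1`. -/
theorem exists_weighted {V : Lp ℂ 2 μ →L[ℂ] Lp ℂ 2 μ} (hV : ∀ f, ‖V f‖ = ‖f‖)
    (hbdd : ∀ f, IsBdd f → IsBdd (V f)) (h1 : ∀ᵐ x ∂μ, ‖V (one μ) x‖ = 1)
    (hmul : ∀ f g, IsBdd f → mulBdd (V f) (V g) = mulBdd (V (one μ)) (V (mulBdd f g))) :
    ∃ (T : X → X) (ψ : X → ℂ), MeasurePreserving T μ μ ∧
      ∀ f : Lp ℂ 2 μ, V f =ᵐ[μ] fun x => ψ x * f (T x) := by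
  have hφ : BddBy 1 (V (one μ)) := h1.mono fun x hx => hx.le
  have hφ' : BddBy 1 (conjL2 (V (one μ))) := hφ.conjL2
  have hcancel : mulBdd (conjL2 (V (one μ))) (V (one μ)) = one μ := by
    rw [mulBdd_eq_iff hφ'.isBdd]
    filter_upwards [h1, coeFn_conjL2 (V (one μ)), coeFn_one (μ := μ)] with x h1 h2 h3
    rw [h2, h3, Complex.star_def, Complex.conj_mul', h1]
    simp
  have hcancel' : ∀ f, mulBdd (V (one μ)) (mulBdd (conjL2 (V (one μ))) f) = f := fun f => by
    rw [mulBdd_assoc hφ.isBdd hφ'.isBdd, mulBdd_comm hφ.isBdd hφ'.isBdd, hcancel, mulBdd_one]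
  have hle : ∀ {g : Lp ℂ 2 μ} (_ : BddBy 1 g) (f : Lp ℂ 2 μ), ‖mulBdd g f‖ ≤ ‖f‖ := fun hg f =>
    (norm_mulBdd_le hg f).trans_eq (one_mul _)
  have hW : IsMulIsometry ((mulBdd (conjL2 (V (one μ)))).comp V) := by
    refine ⟨fun f => ?_, hcancel, fun f hf => hφ'.isBdd.mulBdd (hbdd f hf), fun f g hf => ?_⟩
    · refine le_antisymm ((hle hφ' _).trans_eq (hV f)) ?_
      calc ‖f‖ = ‖mulBdd (V (one μ)) (mulBdd (conjL2 (V (one μ))) (V f))‖ := by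
            rw [hcancel', hV]
        _ ≤ _ := hle hφ _
    · simp only [ContinuousLinearMap.comp_apply]
      set p := conjL2 (V (one μ))
      have hp : IsBdd p := hφ'.isBdd
      have hVf := hbdd f hf
      rw [← mulBdd_assoc hp hVf, mulBdd_assoc hVf hp, mulBdd_comm hVf hp, ← mulBdd_assoc hp hVf,
        hmul f g hf, mulBdd_assoc hp hφ.isBdd (V (mulBdd f g)), hcancel, mulBdd_one]
  obtain ⟨T, hT, hWT⟩ := hW.exists_measurePreserving
  refine ⟨T, V (one μ), hT, fun f => ?_⟩
  have h2 := (mulBdd_eq_iff hφ.isBdd).1 (hcancel' (V f))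
  filter_upwards [h2, hWT f] with x h2 h3
  rw [h2]
  exact congrArg _ h3

variable {U : ℝ → (Lp ℂ 2 μ →L[ℂ] Lp ℂ 2 μ)}

/-- `U t (U (-t) f) = f` reads `f = ω · f ∘ (T (-t) ∘ T t)` with `ω` independent of `f`. Taking `f =
1` gives `ω = 1`, so `T (-t)` inverts `T t`. -/
theorem IsUnitaryC0Group.exists_weighted_invertible (hU : IsUnitaryC0Group U)
    (h : ∀ t : ℝ, ∃ (T : X → X) (ψ : X → ℂ), MeasurePreserving T μ μ ∧
      ∀ f : Lp ℂ 2 μ, U t f =ᵐ[μ] fun x => ψ x * f (T x)) (t : ℝ) :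
    ∃ (T : X → X) (ψ : X → ℂ), MeasurePreserving T μ μ ∧ IsAEInvertible μ T ∧
      ∀ f : Lp ℂ 2 μ, U t f =ᵐ[μ] fun x => ψ x * f (T x) := by
  choose T ψ hT hV using h
  have key : ∀ t, ∀ᵐ x ∂μ, T (-t) (T t x) = x := by
    intro t
    have hcomp : ∀ f : Lp ℂ 2 μ,
        ∀ᵐ x ∂μ, f x = ψ t x * (ψ (-t) (T t x) * f (T (-t) (T t x))) := by
      intro f
      have hf : U t (U (-t) f) = f := by
        simpa using hU.apply_neg_apply (-t) f
      have h1 := hV t (U (-t) f)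
      rw [hf] at h1
      filter_upwards [h1, (hT t).quasiMeasurePreserving.ae_eq_comp (hV (-t) f)] with x h1 h2
      simp only [Function.comp_apply] at h2
      rw [h1, h2]
    have hTT := (hT (-t)).comp (hT t)
    refine ae_eq_self_of_forall_comp_ae_eq hTT fun f => ?_
    filter_upwards [hcomp f, hcomp (one μ), coeFn_one (μ := μ),
      hTT.quasiMeasurePreserving.ae_eq_comp (coeFn_one (μ := μ))] with x h1 h2 h3 h4
    simp only [Function.comp_apply] at h4 ⊢
    rw [h3, h4, mul_one] at h2
    rw [h1, ← mul_assoc, ← h2, one_mul]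
  refine ⟨T t, ψ t, hT t, ⟨T (-t), (hT (-t)).measurable, key t, ?_⟩, hV t⟩
  simpa using key (-t)

end PointRealization

end KoopmanGroup

theorem theorem1p3 {X : Type*} [MeasurableSpace X] [StandardBorelSpace X]
    (μ : Measure X) [IsProbabilityMeasure μ]
    (U : ℝ → (Lp ℂ 2 μ →L[ℂ] Lp ℂ 2 μ))
    (hU : KoopmanGroup.IsUnitaryC0Group U)
    (hbdd : ∀ (t : ℝ) (f : Lp ℂ 2 μ), KoopmanGroup.IsBdd f → KoopmanGroup.IsBdd (U t f))
    (h1 : KoopmanGroup.one μ ∈ (KoopmanGroup.generator U).domain)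
    (hA1 : KoopmanGroup.IsBdd (KoopmanGroup.generator U ⟨KoopmanGroup.one μ, h1⟩)) :
    (∀ t : ℝ, ∃ (T : X → X) (ψ : X → ℂ),
        MeasurePreserving T μ μ ∧ KoopmanGroup.IsAEInvertible μ T ∧
        ∀ f : Lp ℂ 2 μ, (U t f : X → ℂ) =ᵐ[μ] fun x => ψ x * f (T x))
    ↔
    ((∀ t : ℝ, ∀ᵐ x ∂μ, ‖(U t (KoopmanGroup.one μ) : X → ℂ) x‖ = 1) ∧
      KoopmanGroup.IsAlgebra (KoopmanGroup.interBdd (KoopmanGroup.generator U).domain) ∧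
      KoopmanGroup.IsDerivationOn
        (KoopmanGroup.generator U
          - (KoopmanGroup.mulOp (MemLp.toLp _ hA1) : Lp ℂ 2 μ →ₗ[ℂ] Lp ℂ 2 μ).toPMap ⊤)
        (KoopmanGroup.interBdd (KoopmanGroup.generator U).domain)) := by
  constructor
  · intro h
    have hW := hU.isWeightedMul h
    exact ⟨hW.norm_one, hW.isAlgebra_and_isDerivationOn hU h1 hA1⟩
  · rintro ⟨hone, halg, hder⟩
    refine hU.exists_weighted_invertible fun t =>
      KoopmanGroup.exists_weighted (hU.norm_map t) (hbdd t) (hone t) fun f g hf => ?_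
    exact hU.mulBdd_map_map hbdd hA1 (KoopmanGroup.hasDerivAt_generator ⟨_, h1⟩)
      (fun f g f' g' => KoopmanGroup.hasDerivAt_mulBdd_of_isDerivationOn h1 hA1 halg hder) hf t
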